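/- Let $k$ be a field, let $S=k[x_1,\dots,x_n]$ be a standard graded polynomial ring with graded maximal ideal $\mathfrak m=(x_1,\dots,x_n)$, and let $d,t\ge 1$ be integers. For a finitely generated $\mathbb Z$-graded $S$-module $M$ put $\operatorname{reg} M=\sup\{j-i:\operatorname{Tor}^S_i(k,M)_j\neq 0\}$, with $\operatorname{reg} 0=-\infty$. For a homogeneous ideal $I\subseteq S$, a degree-preserving homomorphism $\phi:N\to N'$ of graded $S$-modules is called an $I$-approximation if there are a graded $S$-module $Z$, an injective homomorphism $\alpha:N\to Z$ and a surjective homomorphism $\beta:Z\to N'$, both of degree $0$, with $\phi=\beta\circ\alpha$, $I\operatorname{Coker}\alpha=0$ and $I\operatorname{Ker}\beta=0$. Finitely generated graded $S$-modules $N_1,\dots,N_d$ form a generalized approximation system of degree $t$ for $N$ if there are degree-preserving homomorphisms $\phi_i:N\to N_i$ and homogeneous ideals $I_1,\dots,I_d$ of $S$ such that $\phi_i$ is an $I_i$-approximation for every $i$ and $\mathfrak m^t\subseteq I_1+\cdots+I_d$. A linear form $y\in S_1$ is filter-regular with respect to a graded module $M$ if multiplication by $y$ from $M_m$ to $M_{m+1}$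 is injective for all $m\gg 0$. Let $N$ be a finitely generated graded $S$-module, let $N_1,\dots,N_d$ be a generalized approximation system of degree $t$ for $N$, and let $y\in S_1$ be a linear form that is filter-regular with respect to $N$ and to every $N_i$. Then $$\operatorname{reg} N\le \max\Bigl\{\max_{1\le i\le d}\operatorname{reg} N_i+1,\ \operatorname{reg}(N/yN)\Bigr\}+t-1.$$ -/

import Mathlib

open scoped Pointwise

noncomputable section

namespace GenApprox

open MvPolynomial

universe v w

/-! ## Graded modules over the standard graded polynomial ring `S = k[x_1, …, x_n]` -/

section Graded

variable {k : Type*} [Field k] {n : ℕ}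

variable (k n) in
/-- `𝓜` is a `ℤ`-grading on the `S`-module `M`: `M` is the internal direct sum of the additive
subgroups `𝓜 j` and `S_d • 𝓜 j ⊆ 𝓜 (d + j)`, for the standard grading of `S`. -/
structure IsGradedModule {M : Type*} [AddCommGroup M] [Module (MvPolynomial (Fin n) k) M]
    (𝓜 : ℤ → AddSubgroup M) : Prop where
  isInternal : DirectSum.IsInternal 𝓜
  smul_mem : ∀ (d : ℕ) (j : ℤ) (p : MvPolynomial (Fin n) k) (m : M),
    p.IsHomogeneous d → m ∈ 𝓜 j → p • m ∈ 𝓜 (d + j)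

/-- A homomorphism of graded modules is degree-preserving. -/
def IsDegreePreserving {M M' : Type*} [AddCommGroup M] [Module (MvPolynomial (Fin n) k) M]
    [AddCommGroup M'] [Module (MvPolynomial (Fin n) k) M']
    (𝓜 : ℤ → AddSubgroup M) (𝓜' : ℤ → AddSubgroup M')
    (φ : M →ₗ[MvPolynomial (Fin n) k] M') : Prop :=
  ∀ (j : ℤ), ∀ m ∈ 𝓜 j, φ m ∈ 𝓜' j

/-- An ideal of `S` is homogeneous: it contains the homogeneous components of its elements. -/
def IsHomogeneousIdeal (I : Ideal (MvPolynomial (Fin n) k)) : Prop :=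
  ∀ p ∈ I, ∀ d : ℕ, homogeneousComponent d p ∈ I

/-- The grading induced on a quotient module: the images of the graded pieces. -/
def quotientGrading {M : Type*} [AddCommGroup M] [Module (MvPolynomial (Fin n) k) M]
    (𝓜 : ℤ → AddSubgroup M) (P : Submodule (MvPolynomial (Fin n) k) M) :
    ℤ → AddSubgroup (M ⧸ P) :=
  fun j => (𝓜 j).map P.mkQ.toAddMonoidHom

variable (k n) in
/-- The graded maximal ideal `𝔪 = (x_1, …, x_n)` of `S`. -/
def maxIdeal : Ideal (MvPolynomial (Fin n) k) :=
  Ideal.span (Set.range X)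

end Graded

/-! ## The Koszul resolution of `k` and graded `Tor` -/

section Koszul

variable {n : ℕ}

/-- The sign `(-1)^{#{b ∈ B : b < a}}`. -/
def koszulSign (a : Fin n) (B : Finset (Fin n)) : ℤ :=
  (-1) ^ (B.filter (fun b => b < a)).card

variable (k : Type*) [Field k]

/-- The differential of the Koszul complex `K ⊗ M` on `x_1, …, x_n` with coefficients in `M`.
An element `f` stands for `∑_A e_A ⊗ f(A)`, where `e_A = e_{a_1} ∧ ⋯ ∧ e_{a_i}` for
`A = {a_1 < ⋯ < a_i}`, and
`∂ (e_A ⊗ m) = ∑_r (-1)^{r-1} e_{A ∖ {a_r}} ⊗ x_{a_r} m`. -/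
def koszulDiff (M : Type*) [AddCommGroup M] [Module (MvPolynomial (Fin n) k) M] :
    (Finset (Fin n) → M) →ₗ[MvPolynomial (Fin n) k] (Finset (Fin n) → M) where
  toFun f B := ∑ a ∈ Bᶜ, koszulSign a B • ((X a : MvPolynomial (Fin n) k) • f (insert a B))
  map_add' f g := by
    ext B
    simp [smul_add, Finset.sum_add_distrib]
  map_smul' p f := by
    ext B
    simp only [Pi.smul_apply, RingHom.id_apply, Finset.smul_sum]
    refine Finset.sum_congr rfl fun a _ => ?_
    rw [smul_comm p (koszulSign a B), smul_smul, smul_smul, mul_comm]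

variable {k}

theorem koszulSign_comm {a b : Fin n} {B : Finset (Fin n)} (ha : a ∉ B) (hb : b ∉ B)
    (hab : a ≠ b) :
    koszulSign a B * koszulSign b (insert a B) = -(koszulSign b B * koszulSign a (insert b B)) := by
  unfold koszulSign
  rw [Finset.filter_insert, Finset.filter_insert]
  rcases lt_or_gt_of_ne hab with h | h
  · rw [if_pos h, if_neg (not_lt.mpr h.le), Finset.card_insert_of_notMem (by simp [ha])]
    ring
  · rw [if_neg (not_lt.mpr h.le), if_pos h, Finset.card_insert_of_notMem (by simp [hb])]
    ring

/-- `∂ ∘ ∂ = 0`. -/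
theorem koszulDiff_koszulDiff {M : Type*} [AddCommGroup M] [Module (MvPolynomial (Fin n) k) M]
    (f : Finset (Fin n) → M) : koszulDiff k M (koszulDiff k M f) = 0 := by
  ext B
  simp only [koszulDiff, LinearMap.coe_mk, AddHom.coe_mk, Pi.zero_apply, Finset.smul_sum]
  rw [Finset.sum_sigma']
  refine Finset.sum_involution (fun x _ => ⟨x.2, x.1⟩) ?_ ?_ ?_ ?_
  · rintro ⟨a, b⟩ h
    simp only [Finset.mem_sigma, Finset.mem_compl, Finset.mem_insert, not_or] at h
    obtain ⟨ha, hba, hb⟩ := h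
    have e := koszulSign_comm ha hb (Ne.symm hba)
    simp only [smul_comm _ (koszulSign b (insert a B)), smul_comm _ (koszulSign a (insert b B)),
      smul_smul, Finset.insert_comm b a]
    rw [mul_comm (koszulSign b (insert a B)), e, mul_comm (koszulSign b B), neg_smul,
      mul_comm (X b : MvPolynomial (Fin n) k), neg_add_cancel]
  · rintro ⟨a, b⟩ h _ heq
    simp only [Finset.mem_sigma, Finset.mem_compl, Finset.mem_insert, not_or] at h
    simp only [Sigma.mk.injEq] at heq
    exact h.2.1 heq.1
  · rintro ⟨a, b⟩ h
    simp only [Finset.mem_sigma, Finset.mem_compl, Finset.mem_insert, not_or] at h ⊢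
    exact ⟨h.2.2, fun e => h.2.1 e.symm, h.1⟩
  · rintro ⟨a, b⟩ _
    rfl

/-- The part of a polynomial without the variables `x_a`, `a < b`. -/
def restr (b : Fin n) (p : MvPolynomial (Fin n) k) : MvPolynomial (Fin n) k :=
  ∑ u ∈ p.support.filter (fun u => ∀ a < b, u a = 0), monomial u (coeff u p)

theorem coeff_restr (b : Fin n) (p : MvPolynomial (Fin n) k) (u : Fin n →₀ ℕ) :
    coeff u (restr b p) = if ∀ a < b, u a = 0 then coeff u p else 0 := by
  classical
  unfold restr
  rw [coeff_sum]
  simp only [coeff_monomial, Finset.sum_ite_eq', Finset.mem_filter, mem_support_iff]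
  by_cases h' : coeff u p = 0 <;> simp [h']

/-- A contracting homotopy of the Koszul complex of `S`. -/
def koszulHomotopy (f : Finset (Fin n) → MvPolynomial (Fin n) k) (B : Finset (Fin n)) :
    MvPolynomial (Fin n) k :=
  if h : B.Nonempty then
    restr (B.min' h) ((f (B.erase (B.min' h))).divMonomial (Finsupp.single (B.min' h) 1))
  else 0

theorem coeff_koszulHomotopy (f : Finset (Fin n) → MvPolynomial (Fin n) k) {B : Finset (Fin n)}
    {b : Fin n} (hb : b ∈ B) (hmin : ∀ a ∈ B, b ≤ a) (u : Fin n →₀ ℕ) :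
    coeff u (koszulHomotopy f B) =
      if ∀ a < b, u a = 0 then coeff (Finsupp.single b 1 + u) (f (B.erase b)) else 0 := by
  have h : B.Nonempty := ⟨b, hb⟩
  have e : B.min' h = b := le_antisymm (B.min'_le b hb) (B.le_min' h b hmin)
  rw [koszulHomotopy, dif_pos h, e, coeff_restr, coeff_divMonomial]

theorem coeff_koszulDiff (g : Finset (Fin n) → MvPolynomial (Fin n) k) (A : Finset (Fin n))
    (u : Fin n →₀ ℕ) :
    coeff u (koszulDiff k _ g A) = ∑ a ∈ Aᶜ, koszulSign a A •
      (if a ∈ u.support then coeff (u - Finsupp.single a 1) (g (insert a A)) else 0) := by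
  simp only [koszulDiff, LinearMap.coe_mk, AddHom.coe_mk, coeff_sum, coeff_smul, smul_eq_mul,
    coeff_X_mul']

theorem koszulDiff_koszulHomotopy (f : Finset (Fin n) → MvPolynomial (Fin n) k)
    (hf : koszulDiff k _ f = 0) (h0 : coeff 0 (f ∅) = 0) :
    koszulDiff k _ (koszulHomotopy f) = f := by
  ext A u
  rw [coeff_koszulDiff]
  by_cases hT : (A ∪ u.support).Nonempty
  swap
  · rw [Finset.not_nonempty_iff_eq_empty, Finset.union_eq_empty] at hT
    obtain ⟨rfl, hu⟩ := hT
    rw [Finsupp.support_eq_empty] at hu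
    subst hu
    simp [h0]
  obtain ⟨a₀, ha₀T, hle⟩ : ∃ a₀ ∈ A ∪ u.support, ∀ x ∈ A ∪ u.support, a₀ ≤ x :=
    ⟨_, Finset.min'_mem _ hT, fun x hx => Finset.min'_le _ x hx⟩
  have hlow : ∀ x < a₀, u x = 0 := by
    intro x hx
    by_contra h
    exact absurd (hle x (by simp [h])) (not_le.mpr hx)
  have hAle : ∀ x ∈ A, a₀ ≤ x := fun x hx => hle x (Finset.mem_union_left _ hx)
  have hsign : ∀ B ⊆ A, koszulSign a₀ B = 1 := by
    intro B hB
    unfold koszulSign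
    rw [Finset.filter_eq_empty_iff.mpr fun x hx => not_lt.mpr (hAle x (hB hx))]
    simp
  by_cases ha₀ : a₀ ∈ A
  · have key := congrArg (coeff (Finsupp.single a₀ 1 + u)) (congrFun hf (A.erase a₀))
    rw [coeff_koszulDiff, Finset.compl_erase, Finset.sum_insert (by simp [ha₀]),
      hsign _ (Finset.erase_subset _ _), Finset.insert_erase ha₀, if_pos (by simp),
      add_tsub_cancel_left, one_smul] at key
    simp only [Pi.zero_apply, coeff_zero] at key
    rw [add_eq_zero_iff_eq_neg, ← Finset.sum_neg_distrib] at key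
    rw [key]
    refine Finset.sum_congr rfl fun a ha => ?_
    rw [Finset.mem_compl] at ha
    have hne : a ≠ a₀ := fun h => ha (h ▸ ha₀)
    by_cases hau : a ∈ u.support
    · have hlt : a₀ < a := lt_of_le_of_ne (hle a (Finset.mem_union_right _ hau)) hne.symm
      have hau' : a ∈ (Finsupp.single a₀ 1 + u).support := by
        simp only [Finsupp.mem_support_iff, Finsupp.add_apply] at hau ⊢
        omega
      rw [if_pos hau, if_pos hau', coeff_koszulHomotopy f (Finset.mem_insert_of_mem ha₀)
        (by
          intro x hx
          rcases Finset.mem_insert.mp hx with rfl | hx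
          · exact hlt.le
          · exact hAle x hx), if_pos (by intro x hx; simp [hlow x hx])]
      have hs : koszulSign a A = -koszulSign a (A.erase a₀) := by
        unfold koszulSign
        conv_lhs => rw [← Finset.insert_erase ha₀, Finset.filter_insert, if_pos hlt,
          Finset.card_insert_of_notMem (by simp)]
        ring
      have hu : Finsupp.single a₀ 1 + u - Finsupp.single a 1
          = Finsupp.single a₀ 1 + (u - Finsupp.single a 1) := by
        refine add_tsub_assoc_of_le ?_ _
        rw [Finsupp.single_le_iff]
        rw [Finsupp.mem_support_iff] at hau
        omega
      rw [hs, hu, Finset.erase_insert_of_ne hne, neg_smul]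
    · have hau' : a ∉ (Finsupp.single a₀ 1 + u).support := by
        simp only [Finsupp.mem_support_iff, Finsupp.add_apply, not_not] at hau ⊢
        rw [Finsupp.single_eq_of_ne hne, hau, add_zero]
      rw [if_neg hau, if_neg hau', smul_zero, smul_zero, neg_zero]
  · have hu₀ : a₀ ∈ u.support := (Finset.mem_union.mp ha₀T).resolve_left ha₀
    rw [Finset.sum_eq_single a₀]
    · rw [hsign A subset_rfl, one_smul, if_pos hu₀,
        coeff_koszulHomotopy f (Finset.mem_insert_self _ _)
          (by
            intro x hx
            rcases Finset.mem_insert.mp hx with rfl | hx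
            · exact le_rfl
            · exact hAle x hx), if_pos (by intro x hx; simp [hlow x hx]),
        Finset.erase_insert ha₀, add_tsub_cancel_of_le]
      rw [Finsupp.single_le_iff]
      rw [Finsupp.mem_support_iff] at hu₀
      omega
    · intro a ha hne
      by_cases hau : a ∈ u.support
      · have hlt : a₀ < a := lt_of_le_of_ne (hle a (Finset.mem_union_right _ hau)) hne.symm
        have hlt' : ∀ x ∈ insert a A, a₀ < x := by
          intro x hx
          rcases Finset.mem_insert.mp hx with rfl | hx
          · exact hlt
          · exact lt_of_le_of_ne (hAle x hx) fun h => ha₀ (h ▸ hx)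
        have hB : (insert a A).Nonempty := Finset.insert_nonempty _ _
        rw [if_pos hau, coeff_koszulHomotopy f (Finset.min'_mem _ hB)
          (fun x hx => Finset.min'_le _ x hx), if_neg, smul_zero]
        intro h
        have := h a₀ (hlt' _ (Finset.min'_mem _ hB))
        rw [Finsupp.tsub_apply, Finsupp.single_eq_of_ne hne.symm, tsub_zero] at this
        exact (Finsupp.mem_support_iff.mp hu₀) this
      · rw [if_neg hau, smul_zero]
    · intro h
      exact absurd (Finset.mem_compl.mpr ha₀) h

/-- The Koszul complex of `S` is exact in positive homological degrees. -/
theorem koszul_exact {i : ℕ} (hi : 1 ≤ i) (f : Finset (Fin n) → MvPolynomial (Fin n) k)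
    (hsupp : ∀ A, A.card ≠ i → f A = 0) (hf : koszulDiff k _ f = 0) :
    ∃ g : Finset (Fin n) → MvPolynomial (Fin n) k,
      (∀ A, A.card ≠ i + 1 → g A = 0) ∧ koszulDiff k _ g = f := by
  refine ⟨koszulHomotopy f, fun A hA => ?_, koszulDiff_koszulHomotopy f hf ?_⟩
  · unfold koszulHomotopy
    split_ifs with h
    · have hc : (A.erase (A.min' h)).card ≠ i := by
        rw [Finset.card_erase_of_mem (A.min'_mem h)]
        have := h.card_pos
        omega
      rw [hsupp _ hc]
      simp [restr]
    · rfl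
  · rw [hsupp ∅ (by rw [Finset.card_empty]; omega), coeff_zero]

/-- The image of the Koszul differential in homological degree `0` is `𝔪`, so that the Koszul
complex of `S` is a resolution of `k = S/𝔪`. -/
theorem koszul_augmentation (p : MvPolynomial (Fin n) k) :
    (∃ g : Finset (Fin n) → MvPolynomial (Fin n) k,
      (∀ A, A.card ≠ 1 → g A = 0) ∧ koszulDiff k _ g = Pi.single ∅ p) ↔ p ∈ maxIdeal k n := by
  constructor
  · rintro ⟨g, -, hg⟩
    have h := congrFun hg ∅
    rw [Pi.single_eq_same] at h
    rw [← h]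
    simp only [koszulDiff, LinearMap.coe_mk, AddHom.coe_mk]
    refine Ideal.sum_mem _ fun a _ => zsmul_mem ?_ _
    rw [smul_eq_mul, mul_comm]
    exact Ideal.mul_mem_left _ _ (Ideal.subset_span ⟨a, rfl⟩)
  · intro hp
    have h0 : coeff 0 p = 0 := by
      have hle : maxIdeal k n ≤ RingHom.ker (constantCoeff (R := k) (σ := Fin n)) := by
        refine Ideal.span_le.mpr ?_
        rintro _ ⟨a, rfl⟩
        simp [RingHom.mem_ker]
      simpa [RingHom.mem_ker, constantCoeff_eq] using hle hp
    refine ⟨koszulHomotopy (Pi.single ∅ p), fun A hA => ?_, koszulDiff_koszulHomotopy _ ?_ ?_⟩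
    · unfold koszulHomotopy
      split_ifs with h
      · have hc : A.erase (A.min' h) ≠ ∅ := by
          intro e
          have hcard := Finset.card_erase_of_mem (A.min'_mem h)
          rw [e, Finset.card_empty] at hcard
          have := h.card_pos
          omega
        rw [Pi.single_eq_of_ne hc]
        simp [restr]
      · rfl
    · ext1 B
      simp only [koszulDiff, LinearMap.coe_mk, AddHom.coe_mk, Pi.zero_apply]
      refine Finset.sum_eq_zero fun a _ => ?_
      rw [Pi.single_eq_of_ne (Finset.insert_ne_empty _ _), smul_zero, smul_zero]
    · rw [Pi.single_eq_same, h0]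

end Koszul

section Tor

variable {k : Type*} [Field k] {n : ℕ}

variable (n) in
/-- The component of internal degree `j` of `K_i ⊗ M`; the basis element `e_A` of `K_i`, `|A| = i`,
has degree `i`. -/
def koszulChains {M : Type*} [AddCommGroup M] (𝓜 : ℤ → AddSubgroup M) (i : ℕ) (j : ℤ) :
    AddSubgroup (Finset (Fin n) → M) where
  carrier := {f | ∀ A, (A.card = i → f A ∈ 𝓜 (j - i)) ∧ (A.card ≠ i → f A = 0)}
  zero_mem' A := ⟨fun _ => zero_mem _, fun _ => rfl⟩
  add_mem' {f g} hf hg A := by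
    refine ⟨fun h => add_mem ((hf A).1 h) ((hg A).1 h), fun h => ?_⟩
    rw [Pi.add_apply, (hf A).2 h, (hg A).2 h, add_zero]
  neg_mem' {f} hf A := by
    refine ⟨fun h => neg_mem ((hf A).1 h), fun h => ?_⟩
    rw [Pi.neg_apply, (hf A).2 h, neg_zero]

variable (k n) in
/-- The cycles of `K ⊗ M` in homological degree `i` and internal degree `j`. -/
def koszulCycles {M : Type*} [AddCommGroup M] [Module (MvPolynomial (Fin n) k) M]
    (𝓜 : ℤ → AddSubgroup M) (i : ℕ) (j : ℤ) : AddSubgroup (Finset (Fin n) → M) :=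
  koszulChains n 𝓜 i j ⊓ (koszulDiff k M).toAddMonoidHom.ker

variable (k n) in
/-- The boundaries of `K ⊗ M` in homological degree `i` and internal degree `j`. -/
def koszulBoundaries {M : Type*} [AddCommGroup M] [Module (MvPolynomial (Fin n) k) M]
    (𝓜 : ℤ → AddSubgroup M) (i : ℕ) (j : ℤ) : AddSubgroup (Finset (Fin n) → M) :=
  (koszulChains n 𝓜 (i + 1) j).map (koszulDiff k M).toAddMonoidHom

variable (k n) in
/-- `Tor_i^S(k, M)_j`: the degree `j` part of the `i`-th homology of `K ⊗_S M`, where `K` is the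
Koszul complex, a graded free resolution of `k` over `S` (by `koszulDiff_koszulDiff`,
`koszul_exact` and `koszul_augmentation`). -/
abbrev gradedTor {M : Type*} [AddCommGroup M] [Module (MvPolynomial (Fin n) k) M]
    (𝓜 : ℤ → AddSubgroup M) (i : ℕ) (j : ℤ) : Type _ :=
  koszulCycles k n 𝓜 i j ⧸
    (koszulBoundaries k n 𝓜 i j).addSubgroupOf (koszulCycles k n 𝓜 i j)

variable (k n) in
/-- The Castelnuovo–Mumford regularity `reg M = sup {j - i : Tor_i^S(k, M)_j ≠ 0}`, with
`reg 0 = -∞`. -/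
def regularity {M : Type*} [AddCommGroup M] [Module (MvPolynomial (Fin n) k) M]
    (𝓜 : ℤ → AddSubgroup M) : EReal :=
  sSup {r | ∃ (i : ℕ) (j : ℤ), Nontrivial (gradedTor k n 𝓜 i j) ∧
    r = (((j - i : ℤ) : ℝ) : EReal)}

end Tor

/-! ## Filter-regular elements and generalized approximation systems -/

section Approximation

variable {k : Type*} [Field k] {n : ℕ}

/-- The form `y` is filter-regular on `M`: multiplication by `y` is injective on `M_m` for all
`m ≫ 0`. -/
def IsFilterRegular {M : Type*} [AddCommGroup M] [Module (MvPolynomial (Fin n) k) M]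
    (𝓜 : ℤ → AddSubgroup M) (y : MvPolynomial (Fin n) k) : Prop :=
  ∃ m₀ : ℤ, ∀ m ≥ m₀, Set.InjOn (fun x : M => y • x) (𝓜 m)

/-- `φ : N → N'` is an `I`-approximation of graded modules: it factors as `φ = β ∘ α` with
`α : N → Z` injective, `β : Z → N'` surjective, both of degree `0`, `Z` a graded module, and
`I` annihilates `Coker α` and `Ker β`. -/
def IsApproximation {N : Type v} {N' : Type w} [AddCommGroup N] [Module (MvPolynomial (Fin n) k) N]
    [AddCommGroup N'] [Module (MvPolynomial (Fin n) k) N']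
    (𝓝 : ℤ → AddSubgroup N) (𝓝' : ℤ → AddSubgroup N')
    (I : Ideal (MvPolynomial (Fin n) k)) (φ : N →ₗ[MvPolynomial (Fin n) k] N') : Prop :=
  ∃ (Z : Type (max v w)) (_ : AddCommGroup Z) (_ : Module (MvPolynomial (Fin n) k) Z)
    (𝓩 : ℤ → AddSubgroup Z)
    (α : N →ₗ[MvPolynomial (Fin n) k] Z) (β : Z →ₗ[MvPolynomial (Fin n) k] N'),
    IsGradedModule k n 𝓩 ∧ IsDegreePreserving 𝓝 𝓩 α ∧ IsDegreePreserving 𝓩 𝓝' β ∧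
    β ∘ₗ α = φ ∧ Function.Injective α ∧ Function.Surjective β ∧
    I ≤ Module.annihilator (MvPolynomial (Fin n) k) (Z ⧸ LinearMap.range α) ∧
    I ≤ Module.annihilator (MvPolynomial (Fin n) k) (LinearMap.ker β)

variable (k n) in
/-- The finitely generated graded modules `N' 1, …, N' d` form a generalized approximation system
of degree `t` for `N`: there are degree-preserving homomorphisms `φ i : N → N' i` and homogeneous
ideals `I i` such that `φ i` is an `I i`-approximation and `𝔪 ^ t ⊆ I 1 + ⋯ + I d`. -/
structure IsGenApproxSystem {d : ℕ} {N : Type*} {N' : Fin d → Type*} [AddCommGroup N]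
    [Module (MvPolynomial (Fin n) k) N] [∀ i, AddCommGroup (N' i)]
    [∀ i, Module (MvPolynomial (Fin n) k) (N' i)]
    (𝓝 : ℤ → AddSubgroup N) (𝓝' : ∀ i, ℤ → AddSubgroup (N' i)) (t : ℕ) : Prop where
  finite : ∀ i, Module.Finite (MvPolynomial (Fin n) k) (N' i)
  graded : ∀ i, IsGradedModule k n (𝓝' i)
  exists_maps : ∃ (I : Fin d → Ideal (MvPolynomial (Fin n) k))
    (φ : ∀ i, N →ₗ[MvPolynomial (Fin n) k] N' i),
    (∀ i, IsHomogeneousIdeal (I i)) ∧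
    (∀ i, IsDegreePreserving 𝓝 (𝓝' i) (φ i)) ∧
    (∀ i, IsApproximation 𝓝 (𝓝' i) (I i) (φ i)) ∧
    maxIdeal k n ^ t ≤ ∑ i, I i

end Approximation

end GenApprox

end

namespace GenApprox

open MvPolynomial

section Koszul

variable {k : Type*} [Field k] {n : ℕ}
variable {M : Type*} [AddCommGroup M] [Module (MvPolynomial (Fin n) k) M]

/-! Suppose Tor_i(k, N)_j ≠ 0 and e = j - i exceeds the bound, so that reg(N/yN) ≤ e - t and reg N_l
< e - t for all l. It suffices that y is injective on N_e: since reg(N/yN) < e, a diagram chase in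
the Koszul complex then kills Tor_i(k, N)_j (`IsGradedModule.not_nontrivial_gradedTor`), because y
annihilates Koszul homology.

For injectivity, let x ∈ N_e with yx = 0. Filter-regularity makes x an 𝔪-torsion element. Torsion
vanishes in degrees above the regularity (`KilledFrom.eq_zero`), so in N/yN the image of x is zero;
dividing by y repeatedly gives x = y^t v with v torsion of degree e - t
(`KilledFrom.exists_pow_smul_eq`). Each φ_l(v) is torsion in a degree above reg N_l, hence zero, so
I_l v = 0. As y^t ∈ 𝔪^t ⊆ ∑ I_l, x = y^t v = 0. -/

theorem koszulDiff_apply (f : Finset (Fin n) → M) (B : Finset (Fin n)) :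
    koszulDiff k M f B =
      ∑ a ∈ Bᶜ, koszulSign a B • ((X a : MvPolynomial (Fin n) k) • f (insert a B)) := rfl

/-! ### Linear forms act as zero on Koszul homology. -/

theorem koszulSign_mul_self (a : Fin n) (B : Finset (Fin n)) :
    koszulSign a B * koszulSign a B = 1 := by
  unfold koszulSign
  rw [← mul_pow]
  simp

/-- Exterior multiplication by `e_a` on the Koszul complex. -/
def koszulWedge (a : Fin n) (f : Finset (Fin n) → M) (B : Finset (Fin n)) : M :=
  if a ∈ B then koszulSign a (B.erase a) • f (B.erase a) else 0

/-- Multiplication by `x_a` sends cycles to boundaries. -/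
theorem koszulDiff_koszulWedge (a : Fin n) (f : Finset (Fin n) → M) (hf : koszulDiff k M f = 0) :
    koszulDiff k M (koszulWedge a f) = (X a : MvPolynomial (Fin n) k) • f := by
  ext B
  rw [koszulDiff_apply, Pi.smul_apply]
  -- This is the homotopy formula ∂(e_a ∧ f) + e_a ∧ ∂f = x_a f, in which ∂f = 0. If a ∈ B, the
  -- cycle equation at B ∖ {a} expresses x_a f(B) through the other terms; if a ∉ B, only the term
  -- inserting a survives.
  by_cases ha : a ∈ B
  · obtain ⟨C, haC, rfl⟩ : ∃ C, a ∉ C ∧ B = insert a C :=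
      ⟨B.erase a, by simp, (Finset.insert_erase ha).symm⟩
    have key := congrFun hf C
    have hc : Cᶜ = insert a (insert a C)ᶜ := by
      ext x
      by_cases hx : x = a <;> simp [hx, haC]
    rw [koszulDiff_apply, hc, Finset.sum_insert (by simp), Pi.zero_apply,
      add_eq_zero_iff_eq_neg] at key
    have key' := congrArg (fun m => koszulSign a C • m) key
    simp only [smul_smul, koszulSign_mul_self, one_smul] at key'
    rw [key', ← Finset.sum_neg_distrib, Finset.smul_sum]
    refine Finset.sum_congr rfl fun b hb => ?_
    simp only [Finset.mem_compl, Finset.mem_insert, not_or] at hb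
    have he : (insert b (insert a C)).erase a = insert b C := by
      rw [Finset.insert_comm, Finset.erase_insert]
      simp [haC, Ne.symm hb.1]
    rw [koszulWedge, if_pos (by simp), he, smul_comm (X b : MvPolynomial (Fin n) k), smul_smul,
      smul_neg, smul_smul, ← neg_smul]
    congr 1
    have h := koszulSign_comm haC hb.2 (Ne.symm hb.1)
    linear_combination (koszulSign a (insert b C) * koszulSign a C) * h
      - koszulSign b (insert a C) * koszulSign a (insert b C) * koszulSign_mul_self a C
      - koszulSign a C * koszulSign b C * koszulSign_mul_self a (insert b C)
  · rw [Finset.sum_eq_single a]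
    · rw [koszulWedge, if_pos (by simp), Finset.erase_insert ha,
        smul_comm (X a : MvPolynomial (Fin n) k), smul_smul, koszulSign_mul_self, one_smul]
    · intro b hb hba
      rw [koszulWedge, if_neg (by simp [ha, Ne.symm hba]), smul_zero, smul_zero]
    · intro h
      exact absurd (Finset.mem_compl.mpr ha) h

theorem eq_sum_of_isHomogeneous_one {y : MvPolynomial (Fin n) k} (hy : y.IsHomogeneous 1) :
    y = ∑ a, C (coeff (Finsupp.single a 1) y) * X a := by
  ext u
  simp only [coeff_sum, coeff_C_mul, coeff_X]
  by_cases hu : u.degree = 1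
  · obtain ⟨b, rfl⟩ : ∃ b, u = Finsupp.single b 1 := by
      obtain ⟨b, hb⟩ := Finsupp.ne_iff.mp (show u ≠ 0 by rintro rfl; simp at hu)
      obtain ⟨w, rfl⟩ := exists_add_of_le
        (Finsupp.single_le_iff.mpr (Nat.one_le_iff_ne_zero.mpr hb) : Finsupp.single b 1 ≤ u)
      rw [map_add, Finsupp.degree_single, Nat.add_eq_left, Finsupp.degree_eq_zero_iff] at hu
      exact ⟨b, by rw [hu, add_zero]⟩
    rw [Finset.sum_eq_single b]
    · simp
    · intro c _ hc
      rw [if_neg, mul_zero]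
      intro h
      exact hc (Finsupp.single_left_injective one_ne_zero h)
    · simp
  · rw [hy.coeff_eq_zero hu, Finset.sum_eq_zero]
    intro a _
    rw [if_neg, mul_zero]
    rintro rfl
    simp at hu

theorem mem_maxIdeal_of_isHomogeneous_one {y : MvPolynomial (Fin n) k} (hy : y.IsHomogeneous 1) :
    y ∈ maxIdeal k n := by
  rw [eq_sum_of_isHomogeneous_one hy]
  exact Ideal.sum_mem _ fun a _ => Ideal.mul_mem_left _ _ (Ideal.subset_span ⟨a, rfl⟩)

variable {𝓜 : ℤ → AddSubgroup M}

theorem koszulChains_apply_mem {i : ℕ} {j : ℤ} {f : Finset (Fin n) → M}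
    (hf : f ∈ koszulChains n 𝓜 i j) (A : Finset (Fin n)) : f A ∈ 𝓜 (j - i) := by
  by_cases hA : A.card = i
  · exact (hf A).1 hA
  · rw [(hf A).2 hA]
    exact zero_mem _

theorem koszulWedge_mem_koszulChains (a : Fin n) {i : ℕ} {j : ℤ} {f : Finset (Fin n) → M}
    (hf : f ∈ koszulChains n 𝓜 i j) : koszulWedge a f ∈ koszulChains n 𝓜 (i + 1) (j + 1) := by
  intro A
  unfold koszulWedge
  refine ⟨fun _ => ?_, fun hA => ?_⟩
  · split_ifs with ha
    · have := koszulChains_apply_mem hf (A.erase a)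
      have e : j + 1 - ((i + 1 : ℕ) : ℤ) = j - i := by push_cast; ring
      rw [e]
      exact zsmul_mem this _
    · exact zero_mem _
  · split_ifs with ha
    · rw [(hf _).2, smul_zero]
      have := Finset.card_erase_add_one ha
      omega
    · rfl

theorem koszulDiff_mem_koszulChains
    (hsmul : ∀ (d : ℕ) (j : ℤ) (p : MvPolynomial (Fin n) k) (m : M),
      p.IsHomogeneous d → m ∈ 𝓜 j → p • m ∈ 𝓜 (d + j))
    {i : ℕ} {j : ℤ} {f : Finset (Fin n) → M} (hf : f ∈ koszulChains n 𝓜 (i + 1) j) :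
    koszulDiff k M f ∈ koszulChains n 𝓜 i j := by
  intro A
  rw [koszulDiff_apply]
  refine ⟨fun _ => sum_mem fun a _ => zsmul_mem ?_ _, fun hA => Finset.sum_eq_zero fun a ha => ?_⟩
  · have h := hsmul 1 _ _ _ (isHomogeneous_X k a) (koszulChains_apply_mem hf (insert a A))
    have e : ((1 : ℕ) : ℤ) + (j - ((i + 1 : ℕ) : ℤ)) = j - i := by push_cast; ring
    rwa [e] at h
  · rw [(hf _).2, smul_zero, smul_zero]
    rw [Finset.card_insert_of_notMem (Finset.mem_compl.mp ha)]
    omega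

/-- A linear form annihilates Koszul homology. -/
theorem smul_mem_koszulBoundaries
    (hsmul : ∀ (d : ℕ) (j : ℤ) (p : MvPolynomial (Fin n) k) (m : M),
      p.IsHomogeneous d → m ∈ 𝓜 j → p • m ∈ 𝓜 (d + j))
    {y : MvPolynomial (Fin n) k} (hy : y.IsHomogeneous 1) {i : ℕ} {j : ℤ}
    {f : Finset (Fin n) → M} (hf : f ∈ koszulCycles k n 𝓜 i j) :
    y • f ∈ koszulBoundaries k n 𝓜 i (j + 1) := by
  rw [eq_sum_of_isHomogeneous_one hy, Finset.sum_smul]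
  -- For y = ∑ c_a x_a, the preimage of y f is ∑ c_a (e_a ∧ f).
  refine sum_mem fun a _ => ⟨(C (coeff (Finsupp.single a 1) y) : MvPolynomial (Fin n) k) •
    koszulWedge a f, fun A => ?_, ?_⟩
  · have h := koszulWedge_mem_koszulChains a hf.1 A
    refine ⟨fun hA => ?_, fun hA => ?_⟩
    · have := hsmul 0 _ _ _ (isHomogeneous_C _ (coeff (Finsupp.single a 1) y)) (h.1 hA)
      rwa [Nat.cast_zero, zero_add] at this
    · rw [Pi.smul_apply, h.2 hA, smul_zero]
  · change koszulDiff k M _ = _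
    rw [map_smul, koszulDiff_koszulWedge a f hf.2, smul_smul]

theorem nontrivial_gradedTor_iff {i : ℕ} {j : ℤ} :
    Nontrivial (gradedTor k n 𝓜 i j) ↔
      ∃ f ∈ koszulCycles k n 𝓜 i j, f ∉ koszulBoundaries k n 𝓜 i j := by
  rw [← not_subsingleton_iff_nontrivial, QuotientAddGroup.subsingleton_iff,
    AddSubgroup.addSubgroupOf_eq_top, SetLike.not_le_iff_exists]

/-! ### Torsion elements and regularity. -/

variable (k n) in
/-- The regularity of `M` is less than the integer `e`. -/
def RegularityLT (𝓜 : ℤ → AddSubgroup M) (e : ℤ) : Prop :=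
  ∀ (i : ℕ) (j : ℤ), Nontrivial (gradedTor k n 𝓜 i j) → j - i < e

theorem RegularityLT.mono {e e' : ℤ} (h : RegularityLT k n 𝓜 e) (hle : e ≤ e') :
    RegularityLT k n 𝓜 e' := fun i j hij => (h i j hij).trans_le hle

/-- An element annihilated by all variables gives a class in `Tor_n`. -/
theorem eq_zero_of_forall_X_smul_eq_zero {e : ℤ} (hreg : RegularityLT k n 𝓜 e) {u : M}
    (hu : u ∈ 𝓜 e) (hX : ∀ a : Fin n, (X a : MvPolynomial (Fin n) k) • u = 0) : u = 0 := by
  by_contra hne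
  refine lt_irrefl e ?_
  have : Nontrivial (gradedTor k n 𝓜 n (e + n)) := by
    rw [nontrivial_gradedTor_iff]
    -- The class is that of e_1 ∧ ⋯ ∧ e_n ⊗ u. Since K_{n+1} = 0, the only boundary in homological
    -- degree n is zero.
    refine ⟨Pi.single Finset.univ u, ⟨fun A => ⟨fun hA => ?_, fun hA => ?_⟩, ?_⟩, ?_⟩
    · have : A = Finset.univ := by rwa [← Finset.card_eq_iff_eq_univ, Fintype.card_fin]
      subst this
      simpa using hu
    · rw [Pi.single_eq_of_ne]
      rintro rfl
      simp at hA
    · change koszulDiff k M _ = 0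
      ext B
      rw [koszulDiff_apply]
      refine Finset.sum_eq_zero fun a _ => ?_
      by_cases h : insert a B = Finset.univ
      · rw [h, Pi.single_eq_same, hX, smul_zero]
      · rw [Pi.single_eq_of_ne h, smul_zero, smul_zero]
    · rintro ⟨g, hg, hgu⟩
      have hg0 : g = 0 := by
        ext A
        refine (hg A).2 ?_
        have := A.card_le_univ
        rw [Fintype.card_fin] at this
        omega
      rw [hg0, map_zero] at hgu
      have := congrFun hgu Finset.univ
      rw [Pi.single_eq_same] at this
      exact hne this.symm
  simpa using hreg _ _ this

variable (k n) in
/-- `u` is annihilated by all forms of degree at least `D`. -/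
def KilledFrom (D : ℕ) (u : M) : Prop :=
  ∀ d ≥ D, ∀ p : MvPolynomial (Fin n) k, p.IsHomogeneous d → p • u = 0

theorem KilledFrom.map {M' : Type*} [AddCommGroup M'] [Module (MvPolynomial (Fin n) k) M']
    (φ : M →ₗ[MvPolynomial (Fin n) k] M') {D : ℕ} {u : M} (h : KilledFrom k n D u) :
    KilledFrom k n D (φ u) := fun d hd p hp => by rw [← map_smul, h d hd p hp, map_zero]

/-- The `𝔪`-torsion of `M` lives in degrees at most `reg M`. -/
theorem KilledFrom.eq_zero
    (hsmul : ∀ (d : ℕ) (j : ℤ) (p : MvPolynomial (Fin n) k) (m : M),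
      p.IsHomogeneous d → m ∈ 𝓜 j → p • m ∈ 𝓜 (d + j))
    {D : ℕ} {e : ℤ} {u : M} (h : KilledFrom k n D u) (hreg : RegularityLT k n 𝓜 e)
    (hu : u ∈ 𝓜 e) : u = 0 := by
  induction D generalizing e u with
  | zero => simpa using h 0 le_rfl 1 (isHomogeneous_one _ _)
  | succ D ih =>
    -- Each x_a u is killed one degree earlier and has degree e + 1, where the regularity bound
    -- still applies; by induction it vanishes.
    refine eq_zero_of_forall_X_smul_eq_zero hreg hu fun a => ?_
    refine ih (e := ((1 : ℕ) : ℤ) + e) ?_ (hreg.mono (by simp))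
      (hsmul _ _ _ _ (isHomogeneous_X k a) hu)
    intro d hd p hp
    rw [smul_smul]
    exact h (d + 1) (by omega) _ (hp.mul (isHomogeneous_X k a))

/-! ### Filter-regular forms, homogeneous division and quotients. -/

/-- An element whose product with a filter-regular linear form is torsion is itself torsion. -/
theorem IsFilterRegular.exists_killedFrom
    (hsmul : ∀ (d : ℕ) (j : ℤ) (p : MvPolynomial (Fin n) k) (m : M),
      p.IsHomogeneous d → m ∈ 𝓜 j → p • m ∈ 𝓜 (d + j))
    {y : MvPolynomial (Fin n) k} (hy : IsFilterRegular 𝓜 y) {D : ℕ} {e : ℤ} {u : M}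
    (hu : u ∈ 𝓜 e) (h : KilledFrom k n D (y • u)) : ∃ D', KilledFrom k n D' u := by
  obtain ⟨m₀, hm₀⟩ := hy
  -- The second bound places p u in degree at least m₀, where y is injective; the first gives y p u
  -- = p y u = 0.
  refine ⟨max D (m₀ - e).toNat, fun d hd p hp => ?_⟩
  rw [ge_iff_le, max_le_iff] at hd
  refine hm₀ (d + e) (by omega) (hsmul d e p u hp hu) (zero_mem _) ?_
  change y • p • u = y • (0 : M)
  rw [smul_comm, h d hd.1 p hp, smul_zero]

/-- Multiplication by y raises degree by exactly one, so only the component of v in degree j - 1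
contributes to y v. -/
theorem IsGradedModule.exists_mem_smul_eq (h𝓜 : IsGradedModule k n 𝓜)
    {y : MvPolynomial (Fin n) k} (hy : y.IsHomogeneous 1) {j : ℤ} {v : M}
    (hv : y • v ∈ 𝓜 j) : ∃ w ∈ 𝓜 (j - 1), y • w = y • v := by
  classical
  let _ := h𝓜.isInternal.chooseDecomposition
  refine ⟨DirectSum.decompose 𝓜 v (j - 1), SetLike.coe_mem _, ?_⟩
  have key : ∀ m : M, (DirectSum.decompose 𝓜 (y • m) j : M) =
      y • (DirectSum.decompose 𝓜 m (j - 1) : M) := by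
    intro m
    induction m using DirectSum.Decomposition.inductionOn 𝓜 with
    | zero => simp
    | @homogeneous i m =>
      have hm := h𝓜.smul_mem 1 i y m hy m.2
      by_cases hi : i = j - 1
      · subst hi
        have e : ((1 : ℕ) : ℤ) + (j - 1) = j := by push_cast; ring
        rw [e] at hm
        rw [DirectSum.decompose_of_mem_same 𝓜 hm, DirectSum.decompose_of_mem_same 𝓜 m.2]
      · rw [DirectSum.decompose_of_mem_ne 𝓜 hm (by push_cast; omega),
          DirectSum.decompose_of_mem_ne 𝓜 m.2 hi, smul_zero]
    | add m m' hm hm' => simp [smul_add, hm, hm']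
  rw [← key, DirectSum.decompose_of_mem_same 𝓜 hv]

theorem quotientGrading_smul_mem
    (hsmul : ∀ (d : ℕ) (j : ℤ) (p : MvPolynomial (Fin n) k) (m : M),
      p.IsHomogeneous d → m ∈ 𝓜 j → p • m ∈ 𝓜 (d + j))
    (P : Submodule (MvPolynomial (Fin n) k) M) (d : ℕ) (j : ℤ) (p : MvPolynomial (Fin n) k)
    (m : M ⧸ P) (hp : p.IsHomogeneous d) (hm : m ∈ quotientGrading 𝓜 P j) :
    p • m ∈ quotientGrading 𝓜 P (d + j) := by
  obtain ⟨m, hm, rfl⟩ := hm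
  exact ⟨p • m, hsmul d j p m hp hm, map_smul P.mkQ p m⟩

/-! ### Lifting vanishing of Tor and divisibility from M/yM. -/

theorem koszulDiff_comp {M' : Type*} [AddCommGroup M'] [Module (MvPolynomial (Fin n) k) M']
    (φ : M →ₗ[MvPolynomial (Fin n) k] M') (f : Finset (Fin n) → M) :
    koszulDiff k M' (fun A => φ (f A)) = fun A => φ (koszulDiff k M f A) := by
  ext B
  simp only [koszulDiff_apply, map_sum, map_zsmul, map_smul]

/-- If `y` is injective on `M_e` and `reg (M / yM) < e`, then `Tor_i(k, M)_{i + e} = 0`. -/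
theorem IsGradedModule.not_nontrivial_gradedTor (h𝓜 : IsGradedModule k n 𝓜)
    {y : MvPolynomial (Fin n) k} (hy : y.IsHomogeneous 1) {i : ℕ} {j : ℤ}
    (hinj : ∀ x ∈ 𝓜 (j - i), y • x = 0 → x = 0)
    (hreg : RegularityLT k n (quotientGrading 𝓜 (y • (⊤ : Submodule (MvPolynomial (Fin n) k) M)))
      (j - i)) :
    ¬ Nontrivial (gradedTor k n 𝓜 i j) := by
  rw [nontrivial_gradedTor_iff]
  push Not
  intro z hz
  set P := y • (⊤ : Submodule (MvPolynomial (Fin n) k) M)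
  have hq := mt (hreg i j) (lt_irrefl _)
  rw [nontrivial_gradedTor_iff] at hq
  push Not at hq
  have hzdiff : koszulDiff k M z = 0 := hz.2
  obtain ⟨w', hw', hww'⟩ := hq (fun A => P.mkQ (z A)) ⟨fun A => ⟨fun hA =>
      ⟨z A, (hz.1 A).1 hA, rfl⟩, fun hA => (congrArg P.mkQ ((hz.1 A).2 hA)).trans (map_zero _)⟩, by
    change koszulDiff k (M ⧸ P) (fun A => P.mkQ (z A)) = 0
    rw [koszulDiff_comp, hzdiff]
    simp only [Pi.zero_apply, map_zero]
    rfl⟩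
  -- Modulo y the cycle z bounds; a homogeneous lift w of the bounding chain makes z - ∂w vanish
  -- modulo y.
  have hlift : ∀ A, ∃ m : M, ((A.card = i + 1 → m ∈ 𝓜 (j - (i + 1 : ℕ))) ∧
      (A.card ≠ i + 1 → m = 0)) ∧ P.mkQ m = w' A := by
    intro A
    by_cases hA : A.card = i + 1
    · obtain ⟨m, hm, hmw⟩ := (hw' A).1 hA
      exact ⟨m, ⟨fun _ => hm, fun h => absurd hA h⟩, hmw⟩
    · exact ⟨0, ⟨fun h => absurd h hA, fun _ => rfl⟩, by rw [(hw' A).2 hA, map_zero]⟩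
  choose w hw hwq using hlift
  have hw : w ∈ koszulChains n 𝓜 (i + 1) j := hw
  have hdw := koszulDiff_mem_koszulChains h𝓜.smul_mem hw
  have hrem : z - koszulDiff k M w ∈ koszulChains n 𝓜 i j := sub_mem hz.1 hdw
  have hv : ∀ A, ∃ v : M, ((A.card = i → v ∈ 𝓜 (j - 1 - i)) ∧ (A.card ≠ i → v = 0)) ∧
      y • v = (z - koszulDiff k M w) A := by
    intro A
    by_cases hA : A.card = i
    · have hmem : (z - koszulDiff k M w) A ∈ P := by
        rw [← Submodule.Quotient.mk_eq_zero, ← Submodule.mkQ_apply, Pi.sub_apply, map_sub,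
          sub_eq_zero]
        have h1 := congrFun hww' A
        have h2 := congrFun (koszulDiff_comp P.mkQ w) A
        simp only [hwq] at h2
        exact h1.symm.trans h2
      obtain ⟨v, -, hv⟩ := (Submodule.mem_smul_pointwise_iff_exists _ _ _).mp hmem
      obtain ⟨v', hv', hvv⟩ := h𝓜.exists_mem_smul_eq hy (hv ▸ (hrem A).1 hA)
      refine ⟨v', ⟨fun _ => ?_, fun h => absurd hA h⟩, hvv.trans hv⟩
      have e : j - 1 - (i : ℤ) = j - i - 1 := by ring
      rwa [e]
    · exact ⟨0, ⟨fun h => absurd h hA, fun _ => rfl⟩, by rw [(hrem A).2 hA, smul_zero]⟩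
  choose v hv hvz using hv
  have hv : v ∈ koszulChains n 𝓜 i (j - 1) := hv
  have hyv : y • v = z - koszulDiff k M w := funext hvz
  -- The entries of ∂v lie in degree j - i, exactly where y is injective, and y ∂v = ∂z - ∂∂w = 0.
  -- So v is a cycle, y v is a boundary, and z = y v + ∂w is one too.
  have hdv : koszulDiff k M v = 0 := by
    ext B
    refine hinj _ ?_ ?_
    · rw [koszulDiff_apply]
      refine sum_mem fun a _ => zsmul_mem ?_ _
      have h := h𝓜.smul_mem 1 _ _ _ (isHomogeneous_X k a) (koszulChains_apply_mem hv (insert a B))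
      have e : ((1 : ℕ) : ℤ) + (j - 1 - (i : ℤ)) = j - i := by push_cast; ring
      rwa [e] at h
    · rw [← Pi.smul_apply, ← map_smul, hyv, map_sub, koszulDiff_koszulDiff, hzdiff, sub_zero,
        Pi.zero_apply]
  have hb := smul_mem_koszulBoundaries h𝓜.smul_mem hy (f := v) (i := i) (j := j - 1) ⟨hv, hdv⟩
  rw [sub_add_cancel, hyv] at hb
  have := add_mem hb (⟨w, hw, rfl⟩ : koszulDiff k M w ∈ koszulBoundaries k n 𝓜 i j)
  rwa [sub_add_cancel] at this

/-- A torsion element `u` of degree `e` is divisible by `y ^ s` with torsion quotient, if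
`reg (M / yM) ≤ e - s`. -/
theorem KilledFrom.exists_pow_smul_eq (h𝓜 : IsGradedModule k n 𝓜)
    {y : MvPolynomial (Fin n) k} (hy : y.IsHomogeneous 1) (hyM : IsFilterRegular 𝓜 y)
    {D : ℕ} {e : ℤ} {u : M} (hu : u ∈ 𝓜 e) (h : KilledFrom k n D u) (s : ℕ)
    (hreg : RegularityLT k n (quotientGrading 𝓜 (y • (⊤ : Submodule (MvPolynomial (Fin n) k) M)))
      (e - s + 1)) :
    ∃ D', ∃ v ∈ 𝓜 (e - s), KilledFrom k n D' v ∧ y ^ s • v = u := by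
  induction s with
  | zero => exact ⟨D, u, by simpa using hu, h, by simp⟩
  | succ s ih =>
    obtain ⟨D', v, hv, hvD, rfl⟩ := ih (hreg.mono (by push_cast; omega))
    set P := y • (⊤ : Submodule (MvPolynomial (Fin n) k) M)
    -- The image of v is torsion in degree e - s = e - (s + 1) + 1, above the regularity of M/yM, so
    -- v is divisible by y.
    have h0 : P.mkQ v = 0 :=
      (hvD.map P.mkQ).eq_zero (quotientGrading_smul_mem h𝓜.smul_mem P)
        (hreg.mono (by push_cast; omega)) ⟨v, hv, rfl⟩
    rw [Submodule.mkQ_apply, Submodule.Quotient.mk_eq_zero] at h0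
    obtain ⟨w, -, rfl⟩ := (Submodule.mem_smul_pointwise_iff_exists _ _ _).mp h0
    obtain ⟨w', hw', hww⟩ := h𝓜.exists_mem_smul_eq hy hv
    obtain ⟨D'', hD''⟩ := hyM.exists_killedFrom h𝓜.smul_mem hw' (hww ▸ hvD)
    refine ⟨D'', w', ?_, hD'', ?_⟩
    · have e' : e - ((s + 1 : ℕ) : ℤ) = e - s - 1 := by push_cast; ring
      rwa [e']
    · rw [pow_succ, mul_smul, hww]

/-- Bounding each j - i separately turns the `EReal` inequality into an integer one and covers
regularity -∞ without a case split. -/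
theorem regularityLT_of_regularity_add_lt {e : ℤ} {c : ℤ} {r : EReal}
    (hle : regularity k n 𝓜 + ((c : ℝ) : EReal) ≤ r) (hr : r < ((e : ℝ) : EReal)) :
    RegularityLT k n 𝓜 (e - c) := by
  intro i j hij
  have h : (((j - i : ℤ) : ℝ) : EReal) ≤ regularity k n 𝓜 := le_sSup ⟨i, j, hij, rfl⟩
  have h' := ((add_le_add_left h _).trans hle).trans_lt hr
  rw [← EReal.coe_add, EReal.coe_lt_coe_iff, ← Int.cast_add, Int.cast_lt] at h'
  omega

end Koszul

/-- If φ u = 0 then α u ∈ Ker β is killed by I, and α is injective; so I annihilates Ker φ. -/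
theorem IsApproximation.smul_eq_zero {k : Type*} [Field k] {n : ℕ} {N N' : Type*}
    [AddCommGroup N] [Module (MvPolynomial (Fin n) k) N]
    [AddCommGroup N'] [Module (MvPolynomial (Fin n) k) N']
    {𝓝 : ℤ → AddSubgroup N} {𝓝' : ℤ → AddSubgroup N'} {I : Ideal (MvPolynomial (Fin n) k)}
    {φ : N →ₗ[MvPolynomial (Fin n) k] N'} (h : IsApproximation 𝓝 𝓝' I φ) {u : N} (hu : φ u = 0)
    {p : MvPolynomial (Fin n) k} (hp : p ∈ I) : p • u = 0 := by
  obtain ⟨Z, _, _, 𝓩, α, β, -, -, -, rfl, hα, -, -, hker⟩ := h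
  refine hα ?_
  rw [map_smul, map_zero]
  have := Module.mem_annihilator.mp (hker hp) ⟨α u, hu⟩
  exact congrArg Subtype.val this

end GenApprox

/-! ### The regularity bound. -/

theorem theorem4p9 {k : Type*} [Field k] {n : ℕ} {d t : ℕ} (hd : 1 ≤ d) (ht : 1 ≤ t)
    {N : Type*} [AddCommGroup N] [Module (MvPolynomial (Fin n) k) N]
    [Module.Finite (MvPolynomial (Fin n) k) N]
    (𝓝 : ℤ → AddSubgroup N) (h𝓝 : GenApprox.IsGradedModule k n 𝓝)
    {N' : Fin d → Type*} [∀ i, AddCommGroup (N' i)]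
    [∀ i, Module (MvPolynomial (Fin n) k) (N' i)]
    (𝓝' : ∀ i, ℤ → AddSubgroup (N' i))
    (hsys : GenApprox.IsGenApproxSystem k n 𝓝 𝓝' t)
    (y : MvPolynomial (Fin n) k) (hy : y.IsHomogeneous 1)
    (hyN : GenApprox.IsFilterRegular 𝓝 y)
    (hyN' : ∀ i, GenApprox.IsFilterRegular (𝓝' i) y) :
    GenApprox.regularity k n 𝓝 ≤
      max ((⨆ i, GenApprox.regularity k n (𝓝' i)) + 1)
        (GenApprox.regularity k n
          (GenApprox.quotientGrading 𝓝 (y • (⊤ : Submodule (MvPolynomial (Fin n) k) N))))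
        + ((t : ℝ) - 1 : ℝ) := by
  obtain ⟨I, φ, -, hφdeg, hφ, hI⟩ := hsys.exists_maps
  refine sSup_le ?_
  rintro _ ⟨i, j, hij, rfl⟩
  by_contra! hlt
  have hcast : (((t : ℝ) - 1 : ℝ) : EReal) = ((((t : ℤ) - 1 : ℤ) : ℝ) : EReal) := by push_cast; rfl
  have hregq : GenApprox.RegularityLT k n (GenApprox.quotientGrading 𝓝
      (y • (⊤ : Submodule (MvPolynomial (Fin n) k) N))) (j - i - (t - 1)) := by
    refine GenApprox.regularityLT_of_regularity_add_lt ?_ hlt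
    rw [hcast]
    exact add_le_add_left (le_max_right _ _) _
  have hregN : ∀ l, GenApprox.RegularityLT k n (𝓝' l) (j - i - t) := by
    intro l
    refine GenApprox.regularityLT_of_regularity_add_lt ?_ hlt
    -- The 1 added to reg N_l joins t - 1, giving the sharper threshold e - t needed at the degree
    -- of v.
    have e : (((t : ℤ) : ℝ) : EReal) = 1 + (((t : ℝ) - 1 : ℝ) : EReal) := by
      rw [← EReal.coe_one, ← EReal.coe_add]
      congr 1
      push_cast
      ring
    rw [e, ← add_assoc]
    refine add_le_add_left (le_trans ?_ (le_max_left _ _)) _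
    exact add_le_add_left (le_iSup (fun i => GenApprox.regularity k n (𝓝' i)) l) _
  refine h𝓝.not_nontrivial_gradedTor hy ?_ (hregq.mono (by omega)) hij
  intro x hx hyx
  obtain ⟨D, hD⟩ := hyN.exists_killedFrom h𝓝.smul_mem (D := 0) hx
    (by rw [hyx]; exact fun _ _ _ _ => smul_zero _)
  -- Exactly t divisions are possible, as reg(N/yN) < e - t + 1; t is also the power of 𝔪 covered by
  -- ∑ I_l.
  obtain ⟨D', v, hv, hvD, rfl⟩ := hD.exists_pow_smul_eq h𝓝 hy hyN hx t (hregq.mono (by omega))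
  have hφv : ∀ l, φ l v = 0 := fun l =>
    (hvD.map (φ l)).eq_zero (hsys.graded l).smul_mem (hregN l) (hφdeg l _ v hv)
  have hle : ∑ l, I l ≤ LinearMap.ker (LinearMap.toSpanSingleton (MvPolynomial (Fin n) k) N v) := by
    rw [Ideal.sum_eq_sup]
    exact Finset.sup_le fun l _ p hp => (hφ l).smul_eq_zero (hφv l) hp
  exact hle (hI (Ideal.pow_mem_pow (GenApprox.mem_maxIdeal_of_isHomogeneous_one hy) t))
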